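/- Let $k$ be a field (of any characteristic) and $n\ge 0$. For a ring $A$ with a derivation $d$, let $A((\partial^{-1}))$ be the ring of formal expressions $\sum_{i\le m} a_i\partial^i$ ($m\in\mathbf Z$, $a_i\in A$) with the product $$\Big(\sum_i a_i\partial^i\Big)\Big(\sum_j b_j\partial^j\Big)=\sum_{i,j;\,l\ge 0}\binom{i}{l}a_i\,d^l(b_j)\,\partial^{i+j-l}.$$ Let $P=k((x_1))\dots((x_n))((\partial_1^{-1}))\dots((\partial_n^{-1}))$ be the ring obtained from the field of iterated Laurent series $k((x_1))\dots((x_n))$ by adjoining successively $\partial_1,\dots,\partial_n$ in this way, where $\partial_i$ corresponds to the derivation $\partial/\partial x_i$, extended coefficientwise. Let $V=k((x_1))\dots((x_n))((z_1^{-1}))\dots((z_n^{-1}))$ be the field of iterated Laurent series, and let the symbol of $L=\sum_\beta a_\beta\,\partial_1^{\beta_1}\dots\partial_n^{\beta_n}\in P$, with $a_\beta\in k((x_1))\dots((x_n))$, be $\sigma(L)=\sum_\beta a_\beta\, z_1^{\beta_1}\dots z_n^{\beta_n}\in V$. Let $\mathrm{res}_P(L)\in k$ be the coefficient of $x_1^{-1}\dots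 x_n^{-1}\partial_1^{-1}\dots\partial_n^{-1}$ in $L\in P$, let $\mathrm{res}_V(F)\in k$ be the coefficient of $x_1^{-1}\dots x_n^{-1}z_1^{-1}\dots z_n^{-1}$ in $F\in V$, and put $\langle L,M\rangle=\mathrm{res}_P(LM)$ for $L,M\in P$. Then: i) $\mathrm{res}_P$ is a $k$-linear form on $P$, and $\mathrm{res}_P(L)=\mathrm{res}_V(\sigma(L))$ for all $L\in P$; ii) $\mathrm{res}_P(LM-ML)=0$ for all $L,M\in P$; iii) $\langle\cdot,\cdot\rangle$ is a nondegenerate $k$-bilinear form on $P$: it is $k$-bilinear, if $\langle L,M\rangle=0$ for all $M\in P$ then $L=0$, and if $\langle L,M\rangle=0$ for all $L\in P$ then $M=0$. -/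

import Mathlib

universe u

/-! ### Iterated Laurent series -/

/-- Iterated series in `n` variables over `A`, indexed by the exponents in `Γ`; the first variable
is adjoined first (it is the innermost one), the last variable is adjoined last.
* `IterHahn ℤ n A` is `A((x₁))…((xₙ))`: all exponents are bounded below at each stage.
* `IterHahn ℤᵒᵈ n A` is `A((z₁⁻¹))…((zₙ⁻¹))`: the exponents of `zᵢ` are integers with the opposite
  order, so they are bounded above at each stage. -/
def IterHahn (Γ : Type) [LinearOrder Γ] : ℕ → (A : Type u) → [Zero A] → Type u
  | 0, A, _ => A
  | n + 1, A, _ => IterHahn Γ n (HahnSeries Γ A)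

namespace IterHahn

variable {Γ : Type}

/-- Iterated series over a field form a field, with the usual (commutative) product of series. -/
noncomputable instance instField [AddCommGroup Γ] [LinearOrder Γ] [IsOrderedAddMonoid Γ] :
    (n : ℕ) → (A : Type u) → [Field A] → Field (IterHahn Γ n A)
  | 0, _, inst => inst
  | n + 1, A, _ => instField n (HahnSeries Γ A)

/-- The coefficientwise structure of a vector space over the field of constants. -/
noncomputable instance instModule [AddCommGroup Γ] [LinearOrder Γ] [IsOrderedAddMonoid Γ]
    (k : Type u) [Field k] :
    (n : ℕ) → (A : Type u) → [Field A] → [Module k A] → Module k (IterHahn Γ n A)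
  | 0, _, _, inst => inst
  | n + 1, A, _, _ => instModule k n (HahnSeries Γ A)

/-- `coeff n A f α` is the coefficient of `x₁ ^ α₁ ⋯ xₙ ^ αₙ` in `f`. -/
def coeff [LinearOrder Γ] :
    (n : ℕ) → (A : Type u) → [Zero A] → IterHahn Γ n A → (Fin n → Γ) → A
  | 0, _, _, f, _ => f
  | n + 1, A, _, f, α =>
      HahnSeries.coeff (coeff n (HahnSeries Γ A) f (Fin.tail α)) (α 0)

end IterHahn

/-- Applying an additive map to every coefficient of a one-variable series. -/
noncomputable def HahnSeries.mapHom {Γ : Type} [LinearOrder Γ] {A B : Type u} [AddCommGroup A]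
    [AddCommGroup B] (f : A →+ B) : HahnSeries Γ A →+ HahnSeries Γ B where
  toFun x := x.map f
  map_zero' := by ext; simp
  map_add' x y := HahnSeries.map_add f

namespace IterHahn

/-- Applying an additive map to every coefficient of an iterated Laurent series. -/
noncomputable def map : (n : ℕ) → {A B : Type u} → [Field A] → [Field B] → (A →+ B) →
    (IterHahn ℤ n A →+ IterHahn ℤ n B)
  | 0, _, _, _, _, f => f
  | n + 1, _, _, _, _, f => map n (HahnSeries.mapHom f)

/-- `pderiv n A i` is the partial derivative `∂/∂xᵢ` of `A((x₁))…((xₙ))`. -/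
noncomputable def pderiv : (n : ℕ) → (A : Type u) → [Field A] → Fin n →
    (IterHahn ℤ n A →+ IterHahn ℤ n A)
  | 0, _, _ => fun i => i.elim0
  | n + 1, A, _ =>
      Fin.cases (map n (LaurentSeries.derivative A (V := A)).toAddMonoidHom)
        (fun i => pderiv n (HahnSeries ℤ A) i)

end IterHahn

/-! ### Pseudo-differential operators in one variable -/

/-- The pseudo-differential operators `A((∂⁻¹))`: formal expressions `∑ aᵢ ∂ⁱ`, `i ∈ ℤ`, with
`aᵢ ∈ A` and `aᵢ = 0` for all large `i`. The map `d` enters only through the product. -/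
def PDO (A : Type u) [NonUnitalNonAssocRing A] (_d : A →+ A) : Type u := HahnSeries ℤᵒᵈ A

namespace PDO

variable {A : Type u} [NonUnitalNonAssocRing A] {d : A →+ A}

noncomputable instance : AddCommGroup (PDO A d) :=
  inferInstanceAs (AddCommGroup (HahnSeries ℤᵒᵈ A))

noncomputable instance {k : Type u} [Field k] [Module k A] : Module k (PDO A d) :=
  inferInstanceAs (Module k (HahnSeries ℤᵒᵈ A))

/-- The coefficient of `∂ⁱ`. -/
def coeff (L : PDO A d) (i : ℤ) : A := HahnSeries.coeff L (OrderDual.toDual i)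

@[ext] theorem ext {L M : PDO A d} (h : ∀ i, L.coeff i = M.coeff i) : L = M :=
  HahnSeries.ext (funext h)

@[simp] theorem coeff_zero (i : ℤ) : (0 : PDO A d).coeff i = 0 := rfl

@[simp] theorem coeff_add (L M : PDO A d) (i : ℤ) :
    (L + M).coeff i = L.coeff i + M.coeff i := rfl

@[simp] theorem coeff_smul {k : Type u} [Field k] [Module k A] (c : k) (L : PDO A d) (i : ℤ) :
    (c • L).coeff i = c • L.coeff i := rfl

theorem exists_bound (L : PDO A d) : ∃ N : ℤ, ∀ i, N < i → L.coeff i = 0 :=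
  ⟨OrderDual.ofDual (HahnSeries.order (Γ := ℤᵒᵈ) L), fun _ hi =>
    HahnSeries.coeff_eq_zero_of_lt_order (Γ := ℤᵒᵈ) hi⟩

/-- An operator from its sequence of coefficients. -/
def mk (f : ℤ → A) (hf : ∃ N : ℤ, ∀ i, N < i → f i = 0) : PDO A d :=
  HahnSeries.ofSuppBddBelow (Γ := ℤᵒᵈ) (fun i => f (OrderDual.ofDual i)) (by
    obtain ⟨N, hN⟩ := hf
    refine ⟨OrderDual.toDual N, fun i hi => ?_⟩
    by_contra h
    exact hi (hN _ (not_le.mp h)))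

@[simp] theorem coeff_mk (f : ℤ → A) (hf) (i : ℤ) : (mk f hf : PDO A d).coeff i = f i := rfl

/-- The contribution of `a_i ∂^i`, of `b_j ∂^j` with `j = m - i + k`, and of the `k`-th term of the
Leibniz rule to the coefficient of `∂^m = ∂^(i + j - k)` in a product: `(i choose k) a_i d^k(b_j)`.
The first entry of the pair is `i`, the second one is `k`. -/
noncomputable def mulTerm (L M : PDO A d) (m : ℤ) (p : ℤ × ℕ) : A :=
  Ring.choose p.1 p.2 • (L.coeff p.1 * d^[p.2] (M.coeff (m - p.1 + p.2)))

theorem mulTerm_eq_zero {L M : PDO A d} {m : ℤ} {p : ℤ × ℕ} {N N' : ℤ}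
    (hN : ∀ i, N < i → L.coeff i = 0) (hN' : ∀ i, N' < i → M.coeff i = 0)
    (h : N < p.1 ∨ N' < m - p.1 + p.2) : mulTerm L M m p = 0 := by
  unfold mulTerm
  rcases h with h | h
  · simp [hN _ h]
  · simp [hN' _ h, iterate_map_zero]

theorem finite_mulTerm (L M : PDO A d) (m : ℤ) : (mulTerm L M m).support.Finite := by
  obtain ⟨N, hN⟩ := L.exists_bound
  obtain ⟨N', hN'⟩ := M.exists_bound
  refine ((Set.finite_Icc (m - N') N).prod (Set.finite_Iic (N + N' - m).toNat)).subset ?_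
  rintro ⟨i, k⟩ hp
  have h1 : ¬ (N < i ∨ N' < m - i + k) := fun h => hp (mulTerm_eq_zero hN hN' h)
  simp only [Set.mem_prod, Set.mem_Icc, Set.mem_Iic]
  omega

/-- The product `(∑ a_i ∂^i) (∑ b_j ∂^j) = ∑_{i, j, k ≥ 0} (i choose k) a_i d^k(b_j) ∂^(i + j - k)`;
each coefficient is a finite sum by `finite_mulTerm`. -/
noncomputable instance : Mul (PDO A d) where
  mul L M := mk (fun m => ∑ᶠ p : ℤ × ℕ, mulTerm L M m p) (by
    obtain ⟨N, hN⟩ := L.exists_bound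
    obtain ⟨N', hN'⟩ := M.exists_bound
    refine ⟨N + N', fun m hm => ?_⟩
    rw [← finsum_zero (α := ℤ × ℕ)]
    exact finsum_congr fun p => mulTerm_eq_zero hN hN' (by omega))

theorem coeff_mul (L M : PDO A d) (m : ℤ) :
    (L * M).coeff m = ∑ᶠ p : ℤ × ℕ,
      Ring.choose p.1 p.2 • (L.coeff p.1 * d^[p.2] (M.coeff (m - p.1 + p.2))) := rfl

/-- The product is distributive (this is all that is needed to iterate the construction). -/
noncomputable instance : NonUnitalNonAssocRing (PDO A d) where
  zero_mul L := by
    ext m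
    simp [coeff_mul]
  mul_zero L := by
    ext m
    simp [coeff_mul, iterate_map_zero]
  left_distrib L M M' := by
    ext m
    rw [coeff_add]
    refine Eq.trans (finsum_congr fun p => ?_)
      (finsum_add_distrib (finite_mulTerm L M m) (finite_mulTerm L M' m))
    simp [mulTerm, iterate_map_add, mul_add]
  right_distrib L L' M := by
    ext m
    rw [coeff_add]
    refine Eq.trans (finsum_congr fun p => ?_)
      (finsum_add_distrib (finite_mulTerm L M m) (finite_mulTerm L' M m))
    simp [mulTerm, add_mul]

/-- An additive map of the coefficients, extended to operators by `∑ aᵢ ∂ⁱ ↦ ∑ e(aᵢ) ∂ⁱ`. -/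
noncomputable def extend (d e : A →+ A) : PDO A d →+ PDO A d :=
  HahnSeries.mapHom (Γ := ℤᵒᵈ) e

@[simp] theorem coeff_extend (e : A →+ A) (L : PDO A d) (i : ℤ) :
    (extend d e L).coeff i = e (L.coeff i) := rfl

end PDO

/-! ### Pseudo-differential operators in several variables -/

/-- `A((∂₁⁻¹))…((∂ₙ⁻¹))` for the maps `d₁, …, dₙ` of `A`. First `∂₁` is adjoined by means of `d₁`;
then `d₂, …, dₙ` are extended coefficientwise and the remaining `∂₂, …, ∂ₙ` are adjoined in turn. For
commuting derivations `dᵢ` of a ring `A` this is the iterated ring of operators. -/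
def IterPDO : (n : ℕ) → (A : Type u) → [NonUnitalNonAssocRing A] → (Fin n → (A →+ A)) → Type u
  | 0, A, _, _ => A
  | n + 1, A, _, d => IterPDO n (PDO A (d 0)) (fun i => PDO.extend (d 0) (d i.succ))

namespace IterPDO

/-- The addition and the product of the iterated construction. -/
noncomputable instance instRing : (n : ℕ) → (A : Type u) → [NonUnitalNonAssocRing A] →
    (d : Fin n → (A →+ A)) → NonUnitalNonAssocRing (IterPDO n A d)
  | 0, _, inst, _ => inst
  | n + 1, A, _, d => instRing n (PDO A (d 0)) (fun i => PDO.extend (d 0) (d i.succ))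

noncomputable instance instModule (k : Type u) [Field k] :
    (n : ℕ) → (A : Type u) → [NonUnitalNonAssocRing A] → [Module k A] →
    (d : Fin n → (A →+ A)) → Module k (IterPDO n A d)
  | 0, _, _, inst, _ => inst
  | n + 1, A, _, _, d => instModule k n (PDO A (d 0)) (fun i => PDO.extend (d 0) (d i.succ))

/-- `coeff n A d L β` is the coefficient `a_β ∈ A` of `∂₁ ^ β₁ ⋯ ∂ₙ ^ βₙ` in `L`. -/
noncomputable def coeff : (n : ℕ) → (A : Type u) → [NonUnitalNonAssocRing A] → (d : Fin n → (A →+ A)) →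
    IterPDO n A d → (Fin n → ℤ) → A
  | 0, _, _, _, L, _ => L
  | n + 1, A, _, d, L, β =>
      PDO.coeff (coeff n (PDO A (d 0)) (fun i => PDO.extend (d 0) (d i.succ)) L (Fin.tail β)) (β 0)

/-- The series `∑ a_β z^β` of an operator `∑ a_β ∂^β`: each `∂ᵢ` is replaced by `zᵢ`. -/
noncomputable def symbol : (n : ℕ) → (A : Type u) → [NonUnitalNonAssocRing A] → (d : Fin n → (A →+ A)) →
    IterPDO n A d → IterHahn ℤᵒᵈ n A
  | 0, _, _, _, L => L
  | n + 1, A, _, d, L => symbol n (PDO A (d 0)) (fun i => PDO.extend (d 0) (d i.succ)) L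

/-- The symbol has the coefficients of the operator. -/
theorem coeff_symbol (n : ℕ) (A : Type u) [NonUnitalNonAssocRing A] (d : Fin n → (A →+ A))
    (L : IterPDO n A d) (β : Fin n → ℤ) :
    IterHahn.coeff n A (symbol n A d L) (fun i => OrderDual.toDual (β i)) = coeff n A d L β := by
  induction n generalizing A with
  | zero => rfl
  | succ n ih =>
    exact congrArg (fun M : PDO A (d 0) => M.coeff (β 0))
      (ih (PDO A (d 0)) (fun i => PDO.extend (d 0) (d i.succ)) L (Fin.tail β))

end IterPDO

/-! ### The rings `P` and `V`, symbols, residues and the pairing -/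

/-- The field `k((x₁))…((xₙ))` of iterated Laurent series. -/
abbrev CoeffField (k : Type u) [Field k] (n : ℕ) : Type u := IterHahn ℤ n k

/-- `P = k((x₁))…((xₙ))((∂₁⁻¹))…((∂ₙ⁻¹))`, where `∂ᵢ` acts on the coefficients by `∂/∂xᵢ`. -/
abbrev PseudoDiffOp (k : Type u) [Field k] (n : ℕ) : Type u :=
  IterPDO n (CoeffField k n) (IterHahn.pderiv n k)

/-- The field of symbols `V = k((x₁))…((xₙ))((z₁⁻¹))…((zₙ⁻¹))`. -/
abbrev SymbolField (k : Type u) [Field k] (n : ℕ) : Type u :=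
  IterHahn ℤᵒᵈ n (CoeffField k n)

section

variable {k : Type u} [Field k] {n : ℕ}

/-- The symbol `σ(L) = ∑ a_β z^β` of `L = ∑ a_β ∂^β`. -/
noncomputable def sigma (L : PseudoDiffOp k n) : SymbolField k n :=
  IterPDO.symbol n (CoeffField k n) (IterHahn.pderiv n k) L

/-- The coefficient of `x^α ∂^β` in an operator. -/
noncomputable def coeffP (L : PseudoDiffOp k n) (α β : Fin n → ℤ) : k :=
  IterHahn.coeff n k (IterPDO.coeff n (CoeffField k n) (IterHahn.pderiv n k) L β) α

/-- The coefficient of `x^α z^β` in a symbol. -/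
noncomputable def coeffV (F : SymbolField k n) (α β : Fin n → ℤ) : k :=
  IterHahn.coeff n k (IterHahn.coeff n (CoeffField k n) F (fun i => OrderDual.toDual (β i))) α

/-- The residue of an operator: the coefficient of `x₁⁻¹ ⋯ xₙ⁻¹ ∂₁⁻¹ ⋯ ∂ₙ⁻¹`. -/
noncomputable def resP (L : PseudoDiffOp k n) : k := coeffP L (fun _ => -1) (fun _ => -1)

/-- The residue of a symbol: the coefficient of `x₁⁻¹ ⋯ xₙ⁻¹ z₁⁻¹ ⋯ zₙ⁻¹`. -/
noncomputable def resV (F : SymbolField k n) : k := coeffV F (fun _ => -1) (fun _ => -1)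

/-- The pairing `⟨L, M⟩ = res_P (L M)`. -/
noncomputable def pairing (L M : PseudoDiffOp k n) : k := resP (L * M)

end

/-! The residue is built one `∂` at a time. Over a ring `A` with commuting derivations, call an
additive map `τ` a trace if it vanishes on commutators and on all derivatives. Then taking the
coefficient of `∂⁻¹` and applying `τ` gives a trace on `A((∂⁻¹))` for the remaining derivations,
extended coefficientwise. Vanishing on derivatives is immediate; vanishing on commutators
(`PDO.trace_mul_comm`) is integration by parts, whose sign `(-1)^l` cancels the sign of the
reflected binomial coefficient (`Ring.choose_reflect`). All signs and binomials are integers, so the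
characteristic plays no role. The induction starts from the coefficient of `x₁⁻¹⋯xₙ⁻¹` on the
commutative field of iterated Laurent series, which kills each `∂/∂xᵢ`.

Nondegeneracy passes through the same induction: multiplying by a monomial isolates the leading
coefficient of an operator (`PDO.exists_coeff_mul_eq`), and a nonzero element of the field can be
inverted. One side suffices, because the pairing is symmetric. -/

/-- An additive map satisfying the product rule. -/
def IsLeibniz {A : Type u} [NonUnitalNonAssocRing A] (d : A →+ A) : Prop :=
  ∀ a b, d (a * b) = d a * b + a * d b

/-- If `∂^i` and `∂^j` contribute to `∂⁻¹` through the `l`-th Leibniz term, then `j = l - 1 - i`;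
this compares the binomials of the two orders of multiplication. -/
theorem Ring.choose_reflect (i : ℤ) (l : ℕ) :
    Ring.choose (l - 1 - i) l = (-1) ^ l * Ring.choose i l := by
  rw [show (l : ℤ) - 1 - i = -(i + 1 - l) by ring, Ring.choose_neg,
    show i + 1 - l + l - 1 = i by ring, Int.negOnePow_def, zpow_natCast, Units.smul_def]
  simp

/-! ### Operators in one variable: derivations, traces, leading terms -/

namespace PDO

variable {A : Type u} [NonUnitalNonAssocRing A] {d : A →+ A}

/-- The coefficient of `∂ⁱ` as an additive map. -/
def coeffHom (d : A →+ A) (i : ℤ) : PDO A d →+ A where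
  toFun L := L.coeff i
  map_zero' := rfl
  map_add' _ _ := rfl

theorem map_iterate_of_comm {e d : A →+ A} (h : ∀ a, e (d a) = d (e a)) (l : ℕ) (a : A) :
    e (d^[l] a) = d^[l] (e a) :=
  Function.Semiconj.iterate_right (f := e) (ga := d) (gb := d) h l a

/-- Commutation lets `e` pass through the `d^l` of each product term, where the product rule of `A`
applies. -/
theorem isLeibniz_extend {e : A →+ A} (he : IsLeibniz e) (h : ∀ a, e (d a) = d (e a)) :
    IsLeibniz (extend d e) := by
  intro L M
  ext m
  rw [coeff_extend, coeff_add]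
  refine (e.map_finsum (finite_mulTerm L M m)).trans ?_
  refine Eq.trans (finsum_congr fun p => ?_)
    (finsum_add_distrib (finite_mulTerm (extend d e L) M m) (finite_mulTerm L (extend d e M) m))
  simp only [mulTerm, map_zsmul, he _ _, smul_add, coeff_extend, map_iterate_of_comm h,
    OrderDual.ofDual_toDual]

/-- Integration by parts: since `τ` kills `d (a * b)`, each `d` moves to the other factor at the
cost of a sign. -/
theorem trace_mul_iterate {k : Type*} [AddCommGroup k] (hd : IsLeibniz d) (τ : A →+ k)
    (hτd : ∀ a, τ (d a) = 0) (l : ℕ) (a b : A) :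
    τ (a * d^[l] b) = (-1 : ℤ) ^ l • τ (d^[l] a * b) := by
  induction l generalizing a with
  | zero => simp
  | succ l ih =>
    have h := hτd (a * d^[l] b)
    rw [hd, map_add, ih (d a)] at h
    rw [Function.iterate_succ_apply', Function.iterate_succ_apply, eq_neg_of_add_eq_zero_right h,
      pow_succ, mul_neg_one, neg_smul]

theorem map_coeff_mul {k : Type*} [AddCommGroup k] (τ : A →+ k) (L M : PDO A d) (m : ℤ) :
    τ ((L * M).coeff m) = ∑ᶠ p, τ (mulTerm L M m p) :=
  τ.map_finsum (finite_mulTerm L M m)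

theorem trace_mul_comm {k : Type*} [AddCommGroup k] (hd : IsLeibniz d) (τ : A →+ k)
    (hτd : ∀ a, τ (d a) = 0) (hτ : ∀ a b, τ (a * b) = τ (b * a)) (L M : PDO A d) :
    τ ((L * M).coeff (-1)) = τ ((M * L).coeff (-1)) := by
  rw [map_coeff_mul, map_coeff_mul]
  -- The term of `L * M` with exponents `i` and `j = l - 1 - i` is matched with the term of `M * L`
  -- with these exponents exchanged and the same `l`.
  let e : ℤ × ℕ ≃ ℤ × ℕ := Function.Involutive.toPerm (fun p => (p.2 - 1 - p.1, p.2))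
    fun p => by ext <;> simp
  refine (finsum_congr fun p => ?_).trans (finsum_comp_equiv e)
  obtain ⟨i, l⟩ := p
  change τ (Ring.choose i l • (L.coeff i * d^[l] (M.coeff (-1 - i + l)))) =
    τ (Ring.choose ((l : ℤ) - 1 - i) l •
      (M.coeff (l - 1 - i) * d^[l] (L.coeff (-1 - (l - 1 - i) + l))))
  rw [map_zsmul, map_zsmul, trace_mul_iterate hd τ hτd, hτ, Ring.choose_reflect, mul_smul,
    smul_comm, show -1 - i + (l : ℤ) = l - 1 - i by ring,
    show -1 - ((l : ℤ) - 1 - i) + l = i by ring]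

theorem exists_ne_zero_top {L : PDO A d} (hL : L ≠ 0) :
    ∃ m, L.coeff m ≠ 0 ∧ ∀ i, m < i → L.coeff i = 0 :=
  ⟨OrderDual.ofDual (HahnSeries.order (Γ := ℤᵒᵈ) L),
    fun h => hL (HahnSeries.coeff_order_eq_zero (Γ := ℤᵒᵈ) |>.mp h),
    fun _ hi => HahnSeries.coeff_eq_zero_of_lt_order (Γ := ℤᵒᵈ) hi⟩

theorem exists_coeff_mul_eq {L : PDO A d} {m : ℤ} (hm : ∀ i, m < i → L.coeff i = 0) (b : A)
    (r : ℤ) : ∃ M : PDO A d, (L * M).coeff r = L.coeff m * b := by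
  -- The witness is `b ∂^(r - m)`. A term reaching `∂^r` has `i = m + l`, so `i ≤ m` leaves only
  -- `(m, 0)`, where `b` is not differentiated.
  refine ⟨mk (fun j => if j = r - m then b else 0) ⟨r - m, fun i hi => if_neg hi.ne'⟩, ?_⟩
  rw [coeff_mul, finsum_eq_single _ (m, 0)]
  · simp
  · rintro ⟨i, l⟩ hp
    rcases lt_or_ge m i with hi | hi
    · simp [hm i hi]
    · have : ¬ (r - i + (l : ℤ) = r - m) := fun h => hp (by
        ext <;> simp <;> omega)
      simp [this, iterate_map_zero]

theorem smul_mul' {k : Type u} [Field k] [Module k A]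
    (h : ∀ (c : k) (a b : A), c • a * b = c • (a * b)) (c : k) (L M : PDO A d) :
    c • L * M = c • (L * M) := by
  ext m
  rw [coeff_smul]
  refine Eq.trans (finsum_congr fun p => ?_)
    ((DistribSMul.toAddMonoidHom A c).map_finsum (finite_mulTerm L M m)).symm
  simp only [DistribSMul.toAddMonoidHom_apply, mulTerm, coeff_smul, h, smul_comm c,
    OrderDual.ofDual_toDual]

theorem mul_smul' {k : Type u} [Field k] [Module k A]
    (h : ∀ (c : k) (a b : A), a * c • b = c • (a * b)) (hd : ∀ (c : k) a, d (c • a) = c • d a)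
    (c : k) (L M : PDO A d) : L * c • M = c • (L * M) := by
  ext m
  rw [coeff_smul]
  refine Eq.trans (finsum_congr fun p => ?_)
    ((DistribSMul.toAddMonoidHom A c).map_finsum (finite_mulTerm L M m)).symm
  have hl (l : ℕ) (a : A) : d^[l] (c • a) = c • d^[l] a :=
    (Function.Semiconj.iterate_right (f := (c • · : A → A)) (ga := d) (gb := d)
      (fun a => (hd c a).symm) l a).symm
  simp only [DistribSMul.toAddMonoidHom_apply, mulTerm, coeff_smul, h, hl, smul_comm c,
    OrderDual.ofDual_toDual]

end PDO

/-! ### Induction on the number of adjoined `∂` -/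

namespace IterPDO

theorem coeff_add (n : ℕ) {A : Type u} [NonUnitalNonAssocRing A] (d : Fin n → (A →+ A))
    (L M : IterPDO n A d) (β : Fin n → ℤ) :
    coeff n A d (L + M) β = coeff n A d L β + coeff n A d M β := by
  induction n generalizing A with
  | zero => rfl
  | succ n ih =>
    exact congrArg (fun M : PDO A (d 0) => M.coeff (β 0)) (ih _ L M (Fin.tail β))

theorem coeff_smul {k : Type u} [Field k] (n : ℕ) {A : Type u} [NonUnitalNonAssocRing A]
    [Module k A] (d : Fin n → (A →+ A)) (c : k) (L : IterPDO n A d) (β : Fin n → ℤ) :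
    coeff n A d (c • L) β = c • coeff n A d L β := by
  induction n generalizing A with
  | zero => rfl
  | succ n ih =>
    exact congrArg (fun M : PDO A (d 0) => M.coeff (β 0)) (ih _ L (Fin.tail β))

theorem smul_mul' {k : Type u} [Field k] (n : ℕ) {A : Type u} [NonUnitalNonAssocRing A]
    [Module k A] (d : Fin n → (A →+ A)) (h : ∀ (c : k) (a b : A), c • a * b = c • (a * b))
    (c : k) (L M : IterPDO n A d) : c • L * M = c • (L * M) := by
  induction n generalizing A with
  | zero => exact h c L M
  | succ n ih => exact ih (A := PDO A (d 0)) _ (PDO.smul_mul' h) L M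

theorem mul_smul' {k : Type u} [Field k] (n : ℕ) {A : Type u} [NonUnitalNonAssocRing A]
    [Module k A] (d : Fin n → (A →+ A)) (h : ∀ (c : k) (a b : A), a * c • b = c • (a * b))
    (hd : ∀ i (c : k) a, d i (c • a) = c • d i a)
    (c : k) (L M : IterPDO n A d) : L * c • M = c • (L * M) := by
  induction n generalizing A with
  | zero => exact h c L M
  | succ n ih =>
    refine ih (A := PDO A (d 0)) _ (PDO.mul_smul' h (hd 0)) (fun i c a => ?_) L M
    ext m
    exact hd i.succ c (a.coeff m)

/-- The coefficient ring and the trace must vary in the induction: after one step the coefficients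
no longer commute, and only the trace property survives. -/
theorem trace_mul_comm {k : Type*} [AddCommGroup k] (n : ℕ) {A : Type u}
    [NonUnitalNonAssocRing A] (d : Fin n → (A →+ A)) (hd : ∀ i, IsLeibniz (d i))
    (hc : ∀ i j a, d i (d j a) = d j (d i a)) (τ : A →+ k) (hτd : ∀ i a, τ (d i a) = 0)
    (hτ : ∀ a b, τ (a * b) = τ (b * a)) (L M : IterPDO n A d) :
    τ (coeff n A d (L * M) fun _ => -1) = τ (coeff n A d (M * L) fun _ => -1) := by
  induction n generalizing A with
  | zero => exact hτ L M
  | succ n ih =>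
    refine ih (A := PDO A (d 0)) _ (fun i => PDO.isLeibniz_extend (hd i.succ) (hc _ _))
      (fun i j a => ?_) (τ.comp (PDO.coeffHom (d 0) (-1))) (fun i a => hτd i.succ _)
      (PDO.trace_mul_comm (hd 0) τ (hτd 0) hτ) L M
    ext m
    exact hc i.succ j.succ (a.coeff m)

theorem exists_trace_mul_ne_zero {k : Type*} [AddCommGroup k] (n : ℕ) {A : Type u}
    [NonUnitalNonAssocRing A] (d : Fin n → (A →+ A)) (τ : A →+ k)
    (hτ : ∀ a, a ≠ 0 → ∃ b, τ (a * b) ≠ 0) (L : IterPDO n A d) (hL : L ≠ 0) :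
    ∃ M : IterPDO n A d, τ (coeff n A d (L * M) fun _ => -1) ≠ 0 := by
  induction n generalizing A with
  | zero => exact hτ L hL
  | succ n ih =>
    -- It remains to see that the new trace is still nondegenerate on `A((∂⁻¹))`, which the leading
    -- coefficient shows.
    refine ih (A := PDO A (d 0)) _ (τ.comp (PDO.coeffHom (d 0) (-1))) (fun a ha => ?_) L hL
    obtain ⟨m, hm, hlt⟩ := PDO.exists_ne_zero_top ha
    obtain ⟨b, hb⟩ := hτ _ hm
    obtain ⟨M, hM⟩ := PDO.exists_coeff_mul_eq hlt b (-1)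
    exact ⟨M, fun h => hb (hM ▸ h)⟩

end IterPDO

/-! ### Product rule for one-variable Laurent series -/

namespace HahnSeries

variable {A : Type u} [NonUnitalNonAssocRing A]

theorem support_coeff_mul_coeff_sub_subset (x y : HahnSeries ℤ A) (a : ℤ) :
    (Function.support fun p => x.coeff p * y.coeff (a - p)) ⊆
      ((Finset.antidiagonal x.isPWO_support y.isPWO_support a).image Prod.fst : Finset ℤ) :=
  fun p hp => Finset.mem_image.mpr ⟨(p, a - p), Finset.mem_antidiagonal.mpr
    ⟨left_ne_zero_of_mul hp, right_ne_zero_of_mul hp, add_sub_cancel p a⟩, rfl⟩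

theorem finite_support_coeff_mul_coeff_sub (x y : HahnSeries ℤ A) (a : ℤ) :
    (Function.support fun p => x.coeff p * y.coeff (a - p)).Finite :=
  (Finset.finite_toSet _).subset (support_coeff_mul_coeff_sub_subset x y a)

/-- Frees the index set from the supports of the factors, so that sums for different factors can be
added and shifted termwise. -/
theorem coeff_mul_eq_finsum (x y : HahnSeries ℤ A) (a : ℤ) :
    (x * y).coeff a = ∑ᶠ p, x.coeff p * y.coeff (a - p) := by
  rw [finsum_eq_sum_of_support_subset _ (support_coeff_mul_coeff_sub_subset x y a), coeff_mul,
    Finset.sum_image]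
  · refine Finset.sum_congr rfl fun p hp => ?_
    rw [← (Finset.mem_antidiagonal.mp hp).2.2, add_sub_cancel_left]
  · intro p hp q hq h
    have := (Finset.mem_antidiagonal.mp hp).2.2.trans (Finset.mem_antidiagonal.mp hq).2.2.symm
    exact Prod.ext h (by rw [h] at this; exact add_left_cancel this)

theorem isLeibniz_mapHom {e : A →+ A} (he : IsLeibniz e) :
    IsLeibniz (mapHom e : HahnSeries ℤ A →+ HahnSeries ℤ A) := by
  intro x y
  ext a
  change e ((x * y).coeff a) = (mapHom e x * y).coeff a + (x * mapHom e y).coeff a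
  simp only [coeff_mul_eq_finsum]
  rw [e.map_finsum (finite_support_coeff_mul_coeff_sub x y a), ← finsum_add_distrib
    (finite_support_coeff_mul_coeff_sub _ y a) (finite_support_coeff_mul_coeff_sub x _ a)]
  exact finsum_congr fun p => he _ _

end HahnSeries

namespace LaurentSeries

theorem coeff_derivative {A : Type u} [Field A] (x : HahnSeries ℤ A) (m : ℤ) :
    (derivative A (V := A) x).coeff m = (m + 1) • x.coeff (m + 1) := by
  rw [derivative_apply, hasseDeriv_coeff]
  simp

theorem isLeibniz_derivative (A : Type u) [Field A] :
    IsLeibniz (derivative A (V := A)).toAddMonoidHom := by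
  intro x y
  ext a
  change (derivative A (V := A) (x * y)).coeff a =
    (derivative A (V := A) x * y).coeff a + (x * derivative A (V := A) y).coeff a
  -- Shifting the sum for `x' * y` by one puts both sums over the products `x_p y_(a + 1 - p)`, with
  -- factors `p` and `a + 1 - p`; they add up to `a + 1`.
  rw [HahnSeries.coeff_mul_eq_finsum (derivative A (V := A) x),
    ← finsum_comp_equiv (Equiv.subRight (1 : ℤ)), coeff_derivative,
    HahnSeries.coeff_mul_eq_finsum, HahnSeries.coeff_mul_eq_finsum,
    ← finsum_add_distrib]
  · refine (((DistribSMul.toAddMonoidHom A (a + 1)).map_finsum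
      (HahnSeries.finite_support_coeff_mul_coeff_sub x y (a + 1))).trans
      (finsum_congr fun p => ?_))
    simp only [coeff_derivative, DistribSMul.toAddMonoidHom_apply, Equiv.subRight_apply,
      sub_add_cancel, show a - (p - 1) = a + 1 - p by ring, show a - p + 1 = a + 1 - p by ring]
    simp
    ring
  · exact (HahnSeries.finite_support_coeff_mul_coeff_sub _ y a).preimage
      (Equiv.subRight (1 : ℤ)).injective.injOn
  · exact HahnSeries.finite_support_coeff_mul_coeff_sub x _ a

end LaurentSeries

/-! ### Partial derivatives of iterated Laurent series -/

namespace IterHahn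

theorem ext_coeff {Γ : Type} [LinearOrder Γ] (n : ℕ) {A : Type u} [Zero A] {x y : IterHahn Γ n A}
    (h : ∀ α, coeff n A x α = coeff n A y α) : x = y := by
  induction n generalizing A with
  | zero => exact h Fin.elim0
  | succ n ih =>
    refine ih (A := HahnSeries Γ A) fun α => HahnSeries.ext (funext fun g => ?_)
    exact h (Fin.cons g α)

theorem exists_coeff_eq {Γ : Type} [LinearOrder Γ] (n : ℕ) {A : Type u} [Zero A] (α : Fin n → Γ)
    (a : A) : ∃ x : IterHahn Γ n A, coeff n A x α = a := by
  induction n generalizing A with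
  | zero => exact ⟨a, rfl⟩
  | succ n ih =>
    obtain ⟨x, hx⟩ := ih (Fin.tail α) (HahnSeries.single (α 0) a)
    exact ⟨x, (congrArg (fun y : HahnSeries Γ A => y.coeff (α 0)) hx).trans
      (HahnSeries.coeff_single_same _ _)⟩

theorem coeff_add (n : ℕ) {A : Type u} [Field A] (x y : IterHahn ℤ n A) (α : Fin n → ℤ) :
    coeff n A (x + y) α = coeff n A x α + coeff n A y α := by
  induction n generalizing A with
  | zero => rfl
  | succ n ih =>
    exact congrArg (fun z : HahnSeries ℤ A => z.coeff (α 0))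
      (ih (A := HahnSeries ℤ A) x y (Fin.tail α))

theorem coeff_smul {k : Type u} [Field k] (n : ℕ) {A : Type u} [Field A] [Module k A] (c : k)
    (x : IterHahn ℤ n A) (α : Fin n → ℤ) : coeff n A (c • x) α = c • coeff n A x α := by
  induction n generalizing A with
  | zero => rfl
  | succ n ih =>
    exact congrArg (fun z : HahnSeries ℤ A => z.coeff (α 0))
      (ih (A := HahnSeries ℤ A) x (Fin.tail α))

theorem smul_mul' {k : Type u} [Field k] (n : ℕ) {A : Type u} [Field A] [Module k A]
    (h : ∀ (c : k) (a b : A), c • a * b = c • (a * b)) (c : k) (x y : IterHahn ℤ n A) :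
    c • x * y = c • (x * y) := by
  induction n generalizing A with
  | zero => exact h c x y
  | succ n ih =>
    refine ih (A := HahnSeries ℤ A) (fun c x y => ?_) x y
    ext a
    change ((c • x) * y).coeff a = c • (x * y).coeff a
    simp only [HahnSeries.coeff_mul_eq_finsum]
    exact Eq.trans (finsum_congr fun p => h c _ _) ((DistribSMul.toAddMonoidHom A c).map_finsum
      (HahnSeries.finite_support_coeff_mul_coeff_sub x y a)).symm

theorem coeff_map (n : ℕ) {A B : Type u} [Field A] [Field B] (f : A →+ B) (x : IterHahn ℤ n A)
    (α : Fin n → ℤ) : coeff n B (map n f x) α = f (coeff n A x α) := by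
  induction n generalizing A B with
  | zero => rfl
  | succ n ih =>
    exact congrArg (fun z : HahnSeries ℤ B => z.coeff (α 0))
      (ih (A := HahnSeries ℤ A) (B := HahnSeries ℤ B) (HahnSeries.mapHom f) x (Fin.tail α))

theorem isLeibniz_map (n : ℕ) {A : Type u} [Field A] {f : A →+ A} (hf : IsLeibniz f) :
    IsLeibniz (map n f) := by
  induction n generalizing A with
  | zero => exact hf
  | succ n ih => exact ih (A := HahnSeries ℤ A) (HahnSeries.isLeibniz_mapHom hf)

theorem isLeibniz_pderiv (n : ℕ) (A : Type u) [Field A] (i : Fin n) :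
    IsLeibniz (pderiv n A i) := by
  induction n generalizing A with
  | zero => exact i.elim0
  | succ n ih =>
    cases i using Fin.cases with
    | zero => exact isLeibniz_map n (LaurentSeries.isLeibniz_derivative A)
    | succ i => exact ih (HahnSeries ℤ A) i

/-- This formula yields commutation and linearity of the partial derivatives, and the vanishing of
their residues. -/
theorem coeff_pderiv (n : ℕ) {A : Type u} [Field A] (i : Fin n) (x : IterHahn ℤ n A)
    (α : Fin n → ℤ) :
    coeff n A (pderiv n A i x) α =
      (α i + 1) • coeff n A x (Function.update α i (α i + 1)) := by
  induction n generalizing A with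
  | zero => exact i.elim0
  | succ n ih =>
    cases i using Fin.cases with
    | zero =>
      have h := coeff_map n (LaurentSeries.derivative A (V := A)).toAddMonoidHom x (Fin.tail α)
      refine (congrArg (fun z : HahnSeries ℤ A => z.coeff (α 0)) h).trans ?_
      refine (LaurentSeries.coeff_derivative _ _).trans ?_
      simp [coeff]
    | succ i =>
      have h := ih (A := HahnSeries ℤ A) i x (Fin.tail α)
      refine (congrArg (fun z : HahnSeries ℤ A => z.coeff (α 0)) h).trans ?_
      simp only [coeff, HahnSeries.coeff_smul, Fin.tail, Function.update_of_ne i.succ_ne_zero.symm]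
      congr 3
      ext j
      simp [Function.update_apply]

theorem pderiv_comm (n : ℕ) {A : Type u} [Field A] (i j : Fin n) (x : IterHahn ℤ n A) :
    pderiv n A i (pderiv n A j x) = pderiv n A j (pderiv n A i x) := by
  rcases eq_or_ne i j with rfl | hij
  · rfl
  refine ext_coeff n fun α => ?_
  simp only [coeff_pderiv, Function.update_of_ne hij, Function.update_of_ne hij.symm]
  rw [smul_comm, Function.update_comm hij]

theorem pderiv_smul {k : Type u} [Field k] (n : ℕ) {A : Type u} [Field A] [Module k A] (i : Fin n)
    (c : k) (x : IterHahn ℤ n A) : pderiv n A i (c • x) = c • pderiv n A i x := by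
  refine ext_coeff n fun α => ?_
  simp only [coeff_pderiv, coeff_smul]
  rw [smul_comm]

/-- The coefficient of `x ^ α` as an additive map. -/
noncomputable def coeffHom (n : ℕ) (A : Type u) [Field A] (α : Fin n → ℤ) : IterHahn ℤ n A →+ A :=
  AddMonoidHom.mk' (fun x => coeff n A x α) fun x y => coeff_add n x y α

theorem coeffHom_apply (n : ℕ) {A : Type u} [Field A] (α : Fin n → ℤ) (x : IterHahn ℤ n A) :
    coeffHom n A α x = coeff n A x α := rfl

end IterHahn

/-! ### The residue and the pairing on `P` -/

section

variable {k : Type u} [Field k] {n : ℕ}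

theorem resP_eq (L : PseudoDiffOp k n) :
    resP L = IterHahn.coeffHom n k (fun _ => -1)
      (IterPDO.coeff n (CoeffField k n) (IterHahn.pderiv n k) L fun _ => -1) := rfl

theorem resP_add (L M : PseudoDiffOp k n) : resP (L + M) = resP L + resP M := by
  simp only [resP_eq, IterPDO.coeff_add, map_add]

theorem resP_smul (c : k) (L : PseudoDiffOp k n) : resP (c • L) = c • resP L := by
  simp only [resP_eq, IterPDO.coeff_smul, IterHahn.coeffHom_apply, IterHahn.coeff_smul]

theorem resP_eq_resV_sigma (L : PseudoDiffOp k n) : resP L = resV (sigma L) :=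
  congrArg (fun x => IterHahn.coeff n k x fun _ => -1)
    (IterPDO.coeff_symbol n (CoeffField k n) (IterHahn.pderiv n k) L fun _ => -1).symm

theorem resP_mul_comm (L M : PseudoDiffOp k n) : resP (L * M) = resP (M * L) :=
  IterPDO.trace_mul_comm n _ (IterHahn.isLeibniz_pderiv n k) (IterHahn.pderiv_comm n)
    (IterHahn.coeffHom n k fun _ => -1)
    -- At exponent `-1` the factor `α i + 1` is zero.
    (fun i a => by simp [IterHahn.coeffHom_apply, IterHahn.coeff_pderiv])
    (fun a b => by rw [mul_comm]) L M

theorem exists_resP_mul_ne_zero {L : PseudoDiffOp k n} (hL : L ≠ 0) :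
    ∃ M : PseudoDiffOp k n, resP (L * M) ≠ 0 := by
  refine IterPDO.exists_trace_mul_ne_zero n _ (IterHahn.coeffHom n k fun _ => -1)
    (fun a ha => ?_) L hL
  obtain ⟨x, hx⟩ := IterHahn.exists_coeff_eq n (fun _ => (-1 : ℤ)) (1 : k)
  -- Here `x` has residue `1`, and `a * (a⁻¹ * x) = x`.
  refine ⟨a⁻¹ * x, ?_⟩
  rw [mul_inv_cancel_left₀ ha, IterHahn.coeffHom_apply, hx]
  exact one_ne_zero

theorem PseudoDiffOp.smul_mul' (c : k) (L M : PseudoDiffOp k n) : c • L * M = c • (L * M) :=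
  IterPDO.smul_mul' n _ (IterHahn.smul_mul' n fun c a b => mul_assoc c a b) c L M

theorem PseudoDiffOp.mul_smul' (c : k) (L M : PseudoDiffOp k n) : L * c • M = c • (L * M) :=
  IterPDO.mul_smul' n _ (fun c a b => by
    rw [mul_comm, IterHahn.smul_mul' n fun c a b => mul_assoc c a b, mul_comm])
    (fun i => IterHahn.pderiv_smul n i) c L M

/-- The pairing `⟨L, M⟩ = res_P (L M)` as a bilinear form. -/
noncomputable def pairingForm (k : Type u) [Field k] (n : ℕ) :
    LinearMap.BilinForm k (PseudoDiffOp k n) :=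
  LinearMap.mk₂ k pairing
    (fun L L' M => by rw [pairing, add_mul, resP_add]; rfl)
    (fun c L M => by rw [pairing, PseudoDiffOp.smul_mul', resP_smul]; rfl)
    (fun L M M' => by rw [pairing, mul_add, resP_add]; rfl)
    (fun c L M => by rw [pairing, PseudoDiffOp.mul_smul', resP_smul]; rfl)

theorem pairingForm_nondegenerate (k : Type u) [Field k] (n : ℕ) :
    (pairingForm k n).Nondegenerate := by
  have key (L : PseudoDiffOp k n) (h : ∀ M, resP (L * M) = 0) : L = 0 := by
    by_contra hL
    obtain ⟨M, hM⟩ := exists_resP_mul_ne_zero hL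
    exact hM (h M)
  exact ⟨fun L h => key L h, fun M h => key M fun L => (resP_mul_comm M L).trans (h L)⟩

end

theorem proposition2 (k : Type u) [Field k] (n : ℕ) :
    (IsLinearMap k (resP : PseudoDiffOp k n → k) ∧
      ∀ L : PseudoDiffOp k n, resP L = resV (sigma L)) ∧
    (∀ L M : PseudoDiffOp k n, resP (L * M - M * L) = 0) ∧
    (∃ B : LinearMap.BilinForm k (PseudoDiffOp k n),
      (∀ L M : PseudoDiffOp k n, B L M = pairing L M) ∧ B.Nondegenerate) := by
  refine ⟨⟨⟨resP_add, resP_smul⟩, resP_eq_resV_sigma⟩, fun L M => ?_,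
    pairingForm k n, fun _ _ => rfl, pairingForm_nondegenerate k n⟩
  have h := resP_add (L * M - M * L) (M * L)
  rw [sub_add_cancel, resP_mul_comm L M] at h
  exact right_eq_add.mp h
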